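/- Let $n\ge 1$ and let $h\in\mathbb{R}[x,y,z]$ be a harmonic homogeneous polynomial of degree $n$ (that is, $h$ is homogeneous of degree $n$, possibly zero, and $\Delta h=0$). Then there exist $n$ vectors $w_1,\dots,w_n\in\mathbb{R}^3$ such that $$h(\mathbf{x})=(\mathbf{x}\cdot w_1)\ast\cdots\ast(\mathbf{x}\cdot w_n),\qquad \mathbf{x}=(x,y,z).$$ Here $\ast$ is the harmonic product: every real homogeneous polynomial $p$ of degree $m$ in $x,y,z$ can be written uniquely as $p=h_0+q\,h_1+\dots+q^{r}h_r$ with $q=x^2+y^2+z^2$, $r=\lfloor m/2\rfloor$ and $h_k$ a harmonic homogeneous polynomial of degree $m-2k$; one puts $(p)_0:=h_0$ and, for harmonic homogeneous polynomials $f,g$, $f\ast g:=(fg)_0$. Products of several factors are bracketed from the left, $f_1\ast\cdots\ast f_n=(f_1\ast\cdots\ast f_{n-1})\ast f_n$ (the product is associative and commutative, so the bracketing does not matter). -/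

import Mathlib

/-! Harmonic homogeneous polynomials on `ℝ³`, their harmonic decomposition, and the harmonic
product. Real polynomials in `x, y, z` are elements of `MvPolynomial (Fin 3) ℝ`. -/

namespace HarmonicPoly

open MvPolynomial Finset

/-- The Laplacian `∂²/∂x² + ∂²/∂y² + ∂²/∂z²` on real polynomials in three variables. -/
noncomputable def laplacian : MvPolynomial (Fin 3) ℝ →ₗ[ℝ] MvPolynomial (Fin 3) ℝ :=
  ∑ i : Fin 3, (pderiv i).toLinearMap ∘ₗ (pderiv i).toLinearMap

/-- The quadratic form `x² + y² + z²`. -/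
noncomputable def q : MvPolynomial (Fin 3) ℝ := ∑ i : Fin 3, X i ^ 2

/-- The space of harmonic homogeneous polynomials of degree `n` on `ℝ³`. -/
noncomputable def harmonicSpace (n : ℕ) : Submodule ℝ (MvPolynomial (Fin 3) ℝ) :=
  homogeneousSubmodule (Fin 3) ℝ n ⊓ LinearMap.ker laplacian

/-- `p = h₀ + q h₁ + ⋯ + q ^ r h_r` with `r = ⌊n / 2⌋` and each `h_k` a harmonic homogeneous
polynomial of degree `n - 2k`. -/
def IsHarmonicDecomposition (n : ℕ) (p : MvPolynomial (Fin 3) ℝ)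
    (h : ℕ → MvPolynomial (Fin 3) ℝ) : Prop :=
  (∀ k ∈ range (n / 2 + 1), h k ∈ harmonicSpace (n - 2 * k)) ∧
    p = ∑ k ∈ range (n / 2 + 1), q ^ k * h k

theorem laplacian_apply (p : MvPolynomial (Fin 3) ℝ) :
    laplacian p = ∑ i : Fin 3, pderiv i (pderiv i p) := by
  simp [laplacian]

theorem mem_harmonicSpace {n : ℕ} {p : MvPolynomial (Fin 3) ℝ} :
    p ∈ harmonicSpace n ↔ p.IsHomogeneous n ∧ laplacian p = 0 := by
  simp [harmonicSpace, Submodule.mem_inf, mem_homogeneousSubmodule, LinearMap.mem_ker]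

theorem q_isHomogeneous : q.IsHomogeneous 2 :=
  IsHomogeneous.sum _ _ _ fun i _ => by simpa using (isHomogeneous_X ℝ i).pow 2

theorem laplacian_isHomogeneous {n : ℕ} {p : MvPolynomial (Fin 3) ℝ}
    (hp : p.IsHomogeneous (n + 2)) : (laplacian p).IsHomogeneous n := by
  rw [laplacian_apply]
  exact IsHomogeneous.sum _ _ _ fun i _ => (hp.pderiv (i := i)).pderiv (i := i)

theorem laplacian_q_mul {n : ℕ} {f : MvPolynomial (Fin 3) ℝ} (hf : f.IsHomogeneous n) :
    laplacian (q * f) = (6 + 4 * (n : ℝ)) • f + q * laplacian f := by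
  have euler : ∑ i : Fin 3, X i * pderiv i f = (n : ℝ) • f := by
    rw [hf.sum_X_mul_pderiv, Nat.cast_smul_eq_nsmul]
  have e2 : ((6 + 4 * (n : ℝ)) • f) = 6 * f + 4 * ∑ i : Fin 3, X i * pderiv i f := by
    have c6 : (C 6 : MvPolynomial (Fin 3) ℝ) = 6 := map_ofNat C 6
    have c4 : (C 4 : MvPolynomial (Fin 3) ℝ) = 4 := map_ofNat C 4
    rw [euler, add_smul, mul_smul]
    simp [MvPolynomial.smul_eq_C_mul, c6, c4]
  rw [e2, laplacian_apply, laplacian_apply]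
  simp only [q, Fin.sum_univ_three, pderiv_mul, pderiv_pow, map_add, pderiv_X, Pi.single_apply]
  have d2 : ∀ i : Fin 3, pderiv i (2 : MvPolynomial (Fin 3) ℝ) = 0 := fun i =>
    Derivation.map_natCast (pderiv i) 2
  simp [d2]
  ring

/-- For `h` harmonic of degree `m`, `Δ (q ^ (k + 1) h)` is a nonzero multiple of `q ^ k h`. -/
theorem laplacian_q_pow_mul {m : ℕ} {h : MvPolynomial (Fin 3) ℝ} (hh : h ∈ harmonicSpace m)
    (k : ℕ) :
    laplacian (q ^ (k + 1) * h) =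
      (2 * ((k : ℝ) + 1) * (2 * k + 2 * m + 3)) • (q ^ k * h) := by
  obtain ⟨h1, h2⟩ := mem_harmonicSpace.1 hh
  induction k with
  | zero =>
    rw [zero_add, pow_one, laplacian_q_mul h1, h2, pow_zero, one_mul, mul_zero, add_zero]
    congr 1
    push_cast
    ring
  | succ k ih =>
    have hk : (q ^ (k + 1) * h).IsHomogeneous (2 * (k + 1) + m) :=
      (q_isHomogeneous.pow (k + 1)).mul h1
    rw [pow_succ' q (k + 1), mul_assoc, laplacian_q_mul hk, ih, mul_smul_comm, ← mul_assoc,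
      ← pow_succ' q k, ← add_smul]
    congr 1
    push_cast
    ring

/-- Every homogeneous polynomial has a harmonic decomposition. -/
theorem exists_isHarmonicDecomposition (n : ℕ) {p : MvPolynomial (Fin 3) ℝ}
    (hp : p.IsHomogeneous n) : ∃ h, IsHarmonicDecomposition n p h := by
  induction n using Nat.strong_induction_on generalizing p with
  | _ n ih =>
  by_cases hn : n < 2
  · refine ⟨fun _ => p, ?_, ?_⟩
    · intro k hk
      have hk0 : k = 0 := by simp at hk; omega
      subst hk0
      refine mem_harmonicSpace.2 ⟨by simpa using hp, ?_⟩
      rw [laplacian_apply]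
      refine Finset.sum_eq_zero fun i _ => ?_
      have h0 : (pderiv i p).IsHomogeneous 0 := by
        have := hp.pderiv (i := i)
        rwa [show n - 1 = 0 by omega] at this
      have h1 := (totalDegree_eq_zero_iff_eq_C (p := pderiv i p)).1
        (Nat.le_zero.1 h0.totalDegree_le)
      rw [h1, pderiv_C]
    · rw [show n / 2 = 0 by omega]
      simp
  · obtain ⟨m, rfl⟩ : ∃ m, n = m + 2 := ⟨n - 2, by omega⟩
    obtain ⟨g, hg1, hg2⟩ := ih m (by omega) (laplacian_isHomogeneous hp)
    have hr : (m + 2) / 2 = m / 2 + 1 := by omega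
    let c : ℕ → ℝ := fun k => 2 * ((k : ℝ) + 1) * (2 * k + 2 * ((m - 2 * k : ℕ) : ℝ) + 3)
    have hc : ∀ k, c k ≠ 0 := fun k => by positivity
    let s := ∑ k ∈ range (m / 2 + 1), q ^ (k + 1) * ((c k)⁻¹ • g k)
    have hs : laplacian s = laplacian p := by
      rw [hg2, map_sum]
      refine Finset.sum_congr rfl fun k hk => ?_
      rw [laplacian_q_pow_mul (Submodule.smul_mem _ _ (hg1 k hk)) k, mul_smul_comm, smul_smul]
      rw [mul_inv_cancel₀ (hc k), one_smul]
    have hsh : s.IsHomogeneous (m + 2) := by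
      refine IsHomogeneous.sum _ _ _ fun k hk => ?_
      have h1 := (mem_harmonicSpace.1 (Submodule.smul_mem _ ((c k)⁻¹) (hg1 k hk))).1
      have h2 := (q_isHomogeneous.pow (k + 1)).mul h1
      have hk' : k < m / 2 + 1 := by simpa using hk
      rwa [show 2 * (k + 1) + (m - 2 * k) = m + 2 by omega] at h2
    refine ⟨fun k => Nat.casesOn k (p - s) fun j => (c j)⁻¹ • g j, ?_, ?_⟩
    · intro k hk
      cases k with
      | zero => exact mem_harmonicSpace.2 ⟨by simpa using hp.sub hsh, by simp [hs]⟩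
      | succ j =>
        have hj : j ∈ range (m / 2 + 1) := by simp [hr] at hk ⊢; omega
        have := Submodule.smul_mem _ ((c j)⁻¹) (hg1 j hj)
        rwa [show m - 2 * j = m + 2 - 2 * (j + 1) by omega] at this
    · rw [hr, Finset.sum_range_succ']
      simp [s]

/-- The components of a harmonic decomposition are unique. -/
theorem isHarmonicDecomposition_unique (n : ℕ) {p : MvPolynomial (Fin 3) ℝ}
    {h h' : ℕ → MvPolynomial (Fin 3) ℝ} (hh : IsHarmonicDecomposition n p h)
    (hh' : IsHarmonicDecomposition n p h') : ∀ k ∈ range (n / 2 + 1), h k = h' k := by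
  suffices H : ∀ (n : ℕ) (f : ℕ → MvPolynomial (Fin 3) ℝ),
      IsHarmonicDecomposition n 0 f → ∀ k ∈ range (n / 2 + 1), f k = 0 by
    intro k hk
    refine sub_eq_zero.1 (H n (fun k => h k - h' k) ⟨fun k hk =>
      Submodule.sub_mem _ (hh.1 k hk) (hh'.1 k hk), ?_⟩ k hk)
    simp only [mul_sub, Finset.sum_sub_distrib]
    rw [← hh.2, ← hh'.2, sub_self]
  clear hh hh' h h' p n
  intro n
  induction n using Nat.strong_induction_on with
  | _ n ih =>
  intro f hf
  by_cases hn : n < 2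
  · intro k hk
    have h2 := hf.2
    rw [show n / 2 = 0 by omega] at h2 hk
    have hk0 : k = 0 := by simpa using hk
    subst hk0
    simpa using h2.symm
  · obtain ⟨m, rfl⟩ : ∃ m, n = m + 2 := ⟨n - 2, by omega⟩
    have hr : (m + 2) / 2 = m / 2 + 1 := by omega
    obtain ⟨h1, h2⟩ := hf
    rw [hr] at h1 h2 ⊢
    let c : ℕ → ℝ := fun k => 2 * ((k : ℝ) + 1) * (2 * k + 2 * ((m - 2 * k : ℕ) : ℝ) + 3)
    have hc : ∀ k, c k ≠ 0 := fun k => by positivity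
    have hmem : ∀ k ∈ range (m / 2 + 1), f (k + 1) ∈ harmonicSpace (m - 2 * k) := by
      intro k hk
      have := h1 (k + 1) (by simp at hk ⊢; omega)
      rwa [show m + 2 - 2 * (k + 1) = m - 2 * k by omega] at this
    have h0 : f 0 ∈ harmonicSpace (m + 2) := by simpa using h1 0 (by simp)
    have hsucc : ∀ k ∈ range (m / 2 + 1), f (k + 1) = 0 := by
      have := ih m (by omega) (fun k => c k • f (k + 1))
        ⟨fun k hk => Submodule.smul_mem _ _ (hmem k hk), ?_⟩
      · intro k hk
        exact (smul_eq_zero.1 (this k hk)).resolve_left (hc k)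
      · have h3 := congrArg laplacian h2
        rw [Finset.sum_range_succ', map_add, map_sum, map_zero, pow_zero, one_mul,
          (mem_harmonicSpace.1 h0).2, add_zero] at h3
        rw [h3]
        refine Finset.sum_congr rfl fun k hk => ?_
        rw [laplacian_q_pow_mul (hmem k hk) k, mul_smul_comm]
    intro k hk
    cases k with
    | succ j => exact hsucc j (by simp at hk ⊢; omega)
    | zero =>
      rw [Finset.sum_range_succ', Finset.sum_eq_zero, zero_add, pow_zero, one_mul] at h2
      · exact h2.symm
      · intro k hk
        rw [hsucc k hk, mul_zero]

/-- The harmonic projection `p ↦ (p)₀` of homogeneous polynomials of degree `n`: the leading term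
`h₀` of the (unique) harmonic decomposition of `p`. -/
noncomputable def harmonicProj (n : ℕ) (p : homogeneousSubmodule (Fin 3) ℝ n) :
    harmonicSpace n :=
  ⟨(exists_isHarmonicDecomposition n p.2).choose 0,
    (exists_isHarmonicDecomposition n p.2).choose_spec.1 0 (by simp)⟩

theorem harmonicProj_eq {n : ℕ} (p : homogeneousSubmodule (Fin 3) ℝ n)
    {h : ℕ → MvPolynomial (Fin 3) ℝ} (hh : IsHarmonicDecomposition n p h) :
    (harmonicProj n p : MvPolynomial (Fin 3) ℝ) = h 0 :=
  isHarmonicDecomposition_unique n (exists_isHarmonicDecomposition n p.2).choose_spec hh 0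
    (by simp)

/-- The harmonic product `h₁ ∗ h₂ = (h₁ h₂)₀`. -/
noncomputable def harmonicMul {m n : ℕ} (h₁ : harmonicSpace m) (h₂ : harmonicSpace n) :
    harmonicSpace (m + n) :=
  harmonicProj (m + n) ⟨h₁ * h₂,
    IsHomogeneous.mul (mem_harmonicSpace.1 h₁.2).1 (mem_harmonicSpace.1 h₂.2).1⟩

/-- The constant polynomial `1`, the unit of the harmonic product. -/
noncomputable def harmonicOne : harmonicSpace 0 :=
  ⟨1, mem_harmonicSpace.2 ⟨isHomogeneous_one _ _, by simp [laplacian_apply]⟩⟩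

/-- The linear form `x ↦ x · w`, a harmonic polynomial of degree one. -/
noncomputable def linForm (w : EuclideanSpace ℝ (Fin 3)) : harmonicSpace 1 :=
  ⟨∑ i : Fin 3, C (w i) * X i, mem_harmonicSpace.2
    ⟨IsHomogeneous.sum _ _ _ fun i _ => by
        simpa using (isHomogeneous_C (Fin 3) (w i)).mul (isHomogeneous_X ℝ i),
      by
        simp [laplacian_apply, pderiv_X, Pi.single_apply, Fin.sum_univ_three]⟩⟩

/-- The map `(w₁, …, wₙ) ↦ (x · w₁) ∗ ⋯ ∗ (x · wₙ)`, with brackets to the left; the empty product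
is `1`. -/
noncomputable def sylvesterMap :
    (n : ℕ) → (Fin n → EuclideanSpace ℝ (Fin 3)) → harmonicSpace n
  | 0, _ => harmonicOne
  | n + 1, w => harmonicMul (sylvesterMap n fun i => w i.castSucc) (linForm (w (Fin.last n)))

end HarmonicPoly

namespace HarmonicPoly

open Polynomial

/-! Restrict polynomials to the isotropic conic `q = 0`, parametrized by `u`. Since `q` restricts to
zero, the harmonic product becomes the ordinary product in `ℂ[X]` (`restrictConic_harmonicMul`), and
a harmonic form is determined by its restriction (`eq_zero_of_restrictConic_eq_zero`). It is
therefore enough to factor the restriction.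

The restriction of a real form of degree `n` has degree at most `2n` and is, up to sign, invariant
under the antipodal map `u ↦ -1 / conj u`, which has no fixed point on the Riemann sphere. Its
roots, `∞` included, thus split into antipodal pairs, and the quadratic of each pair is the
restriction of a real linear form. Splitting off one pair at a time gives the vectors. -/

theorem pderiv_comm (i j : Fin 3) (p : MvPolynomial (Fin 3) ℝ) :
    MvPolynomial.pderiv i (MvPolynomial.pderiv j p) =
      MvPolynomial.pderiv j (MvPolynomial.pderiv i p) := by
  have h : ⁅(MvPolynomial.pderiv i : Derivation ℝ (MvPolynomial (Fin 3) ℝ)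
      (MvPolynomial (Fin 3) ℝ)), (MvPolynomial.pderiv j : Derivation ℝ (MvPolynomial (Fin 3) ℝ)
      (MvPolynomial (Fin 3) ℝ))⁆ = 0 := by
    refine MvPolynomial.derivation_ext fun k => ?_
    rw [Derivation.commutator_apply]
    simp only [MvPolynomial.pderiv_X, Pi.single_apply]
    split_ifs <;> simp
  have := congrArg (fun D => D p) h
  rw [Derivation.commutator_apply] at this
  exact sub_eq_zero.1 this

theorem pderiv_mem_harmonicSpace {n : ℕ} {h : MvPolynomial (Fin 3) ℝ}
    (hh : h ∈ harmonicSpace (n + 1)) (i : Fin 3) :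
    MvPolynomial.pderiv i h ∈ harmonicSpace n := by
  obtain ⟨h1, h2⟩ := mem_harmonicSpace.1 hh
  refine mem_harmonicSpace.2 ⟨h1.pderiv, ?_⟩
  rw [laplacian_apply] at h2 ⊢
  have := congrArg (MvPolynomial.pderiv i) h2
  rw [map_sum, map_zero] at this
  rw [← this]
  refine Finset.sum_congr rfl fun j _ => ?_
  rw [pderiv_comm j i h, pderiv_comm j i]

/-! ### Restriction to the isotropic conic -/

/-- A rational parametrization `u ↦ (1 - u², i (1 + u²), 2u)` of the isotropic conic. -/
noncomputable def isotropicCurve : Fin 3 → ℂ[X] :=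
  ![1 - X ^ 2, C Complex.I * (1 + X ^ 2), 2 * X]

/-- Restriction of real polynomials to the isotropic conic. -/
noncomputable def restrictConic : MvPolynomial (Fin 3) ℝ →ₐ[ℝ] ℂ[X] :=
  MvPolynomial.aeval isotropicCurve

theorem C_I_sq : (C Complex.I : ℂ[X]) ^ 2 = -1 := by
  rw [← C_pow, Complex.I_sq, C_neg, C_1]

theorem restrictConic_q : restrictConic q = 0 := by
  rw [q, map_sum, Fin.sum_univ_three]
  simp only [map_pow, restrictConic, MvPolynomial.aeval_X, isotropicCurve, Matrix.cons_val]
  linear_combination (1 + X ^ 2) ^ 2 * C_I_sq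

theorem derivative_restrictConic (p : MvPolynomial (Fin 3) ℝ) :
    derivative (restrictConic p) =
      ∑ i, restrictConic (MvPolynomial.pderiv i p) * derivative (isotropicCurve i) := by
  induction p using MvPolynomial.induction_on with
  | C a => simp [restrictConic, IsScalarTower.algebraMap_apply ℝ ℂ ℂ[X]]
  | add p q hp hq => simp [hp, hq, add_mul, Finset.sum_add_distrib]
  | mul_X p i hp =>
    have hX : restrictConic (MvPolynomial.X i) = isotropicCurve i := MvPolynomial.aeval_X _ _
    have hd (j : Fin 3) : restrictConic (MvPolynomial.pderiv j (p * MvPolynomial.X i)) =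
        restrictConic (MvPolynomial.pderiv j p) * isotropicCurve i +
          if j = i then restrictConic p else 0 := by
      rw [MvPolynomial.pderiv_mul, map_add, map_mul, hX, MvPolynomial.pderiv_X]
      by_cases hj : j = i
      · subst hj
        simp
      · simp [hj]
    rw [map_mul, hX, derivative_mul, hp, Finset.sum_mul]
    simp only [hd, add_mul, Finset.sum_add_distrib, ite_mul, zero_mul, Finset.sum_ite_eq',
      Finset.mem_univ, if_true]
    exact congrArg₂ _ (Finset.sum_congr rfl fun j _ => mul_right_comm _ _ _) rfl

theorem restrictConic_euler {n : ℕ} {p : MvPolynomial (Fin 3) ℝ} (hp : p.IsHomogeneous n) :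
    ∑ i, isotropicCurve i * restrictConic (MvPolynomial.pderiv i p) =
      (n : ℂ[X]) * restrictConic p := by
  have := congrArg restrictConic hp.sum_X_mul_pderiv
  simpa [restrictConic] using this

/-- If a harmonic polynomial vanishes on the isotropic conic, so does its gradient. -/
theorem restrictConic_pderiv_eq_zero {m : ℕ} {h : MvPolynomial (Fin 3) ℝ}
    (hh : h ∈ harmonicSpace (m + 1)) (h0 : restrictConic h = 0) (i : Fin 3) :
    restrictConic (MvPolynomial.pderiv i h) = 0 := by
  obtain ⟨hhom, hlap⟩ := mem_harmonicSpace.1 hh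
  have e1 := restrictConic_euler hhom
  have e2 := (derivative_restrictConic h).symm
  have hE (i : Fin 3) := restrictConic_euler (hhom.pderiv (i := i))
  have hL := congrArg restrictConic hlap
  rw [h0] at e1 e2
  rw [derivative_zero] at e2
  rw [laplacian_apply] at hL
  have hD := congrArg derivative e2
  simp only [Fin.sum_univ_three, derivative_mul, map_add, derivative_restrictConic,
    derivative_zero] at hD
  have E0 := hE 0
  have E1 := hE 1
  have E2 := hE 2
  simp only [Fin.sum_univ_three, map_add, map_zero, mul_zero, add_tsub_cancel_right,
    pderiv_comm 1 0 h, pderiv_comm 2 0 h, pderiv_comm 2 1 h] at e1 e2 hL hD E0 E1 E2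
  simp [isotropicCurve] at e1 e2 hL hD E0 E1 E2
  have hI := C_I_sq
  generalize (C Complex.I : ℂ[X]) = I at *
  generalize g0 : restrictConic (MvPolynomial.pderiv 0 h) = G0 at *
  generalize g1 : restrictConic (MvPolynomial.pderiv 1 h) = G1 at *
  generalize g2 : restrictConic (MvPolynomial.pderiv 2 h) = G2 at *
  generalize restrictConic (MvPolynomial.pderiv 1 (MvPolynomial.pderiv 1 h)) = H11 at *
  -- For the curve `γ`, `γ' γ'ᵀ = 4 Id + γ γ''ᵀ + γ'' γᵀ`. Contracting with the Hessian, harmonicity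
  -- removes the trace and Euler's identity for the partials gives `2m γ''·∇h`; the second
  -- derivative of `h ∘ γ = 0` adds one more `γ''·∇h`.
  have key : (2 * (m : ℂ[X]) + 1) * (-2 * G0 + 2 * I * G1) = 0 := by
    linear_combination hD - 4 * hL - 2 * (-2 * E0 + 2 * I * E1) + 4 * H11 * hI
  have hm : (2 * (m : ℂ[X]) + 1) ≠ 0 := by exact_mod_cast Nat.succ_ne_zero (2 * m)
  have e3 := (mul_eq_zero.1 key).resolve_left hm
  -- `∇h` is now orthogonal to `γ`, `γ'` and `γ''`, which are linearly independent at every `u`.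
  have f0 : (4 : ℂ[X]) * G0 = 0 := by
    linear_combination 2 * e1 - 2 * X * e2 + X ^ 2 * e3 - e3
  have f1 : (4 : ℂ[X]) * G1 = 0 := by
    linear_combination (-I) * (2 * e1 - 2 * X * e2 + X ^ 2 * e3 + e3) + 4 * G1 * hI
  have f2 : (2 : ℂ[X]) * G2 = 0 := by
    linear_combination e2 - X * e3
  fin_cases i
  · exact g0.trans ((mul_eq_zero.1 f0).resolve_left (by norm_num))
  · exact g1.trans ((mul_eq_zero.1 f1).resolve_left (by norm_num))
  · exact g2.trans ((mul_eq_zero.1 f2).resolve_left (by norm_num))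

/-- Induction on the degree: the partials are harmonic and again vanish on the conic, so they are
zero, and Euler's identity recovers `h`. -/
theorem eq_zero_of_restrictConic_eq_zero {n : ℕ} {h : MvPolynomial (Fin 3) ℝ}
    (hh : h ∈ harmonicSpace n) (h0 : restrictConic h = 0) : h = 0 := by
  induction n generalizing h with
  | zero =>
    have h1 := (MvPolynomial.totalDegree_eq_zero_iff_eq_C (p := h)).1
      (Nat.le_zero.1 (mem_harmonicSpace.1 hh).1.totalDegree_le)
    rw [h1] at h0 ⊢
    have h2 : (algebraMap ℝ ℂ[X]) (MvPolynomial.coeff 0 h) = 0 := by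
      simpa [restrictConic] using h0
    rw [(map_eq_zero _).1 h2, map_zero]
  | succ m ih =>
    have hd (i : Fin 3) : MvPolynomial.pderiv i h = 0 :=
      ih (pderiv_mem_harmonicSpace hh i) (restrictConic_pderiv_eq_zero hh h0 i)
    have := (mem_harmonicSpace.1 hh).1.sum_X_mul_pderiv
    simp only [hd, mul_zero, Finset.sum_const_zero] at this
    exact (smul_eq_zero.1 this.symm).resolve_left (Nat.succ_ne_zero m)

/-- The projection changes `p` only by a multiple of `q`. -/
theorem restrictConic_harmonicProj {n : ℕ} (p : MvPolynomial.homogeneousSubmodule (Fin 3) ℝ n) :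
    restrictConic (harmonicProj n p) = restrictConic p := by
  obtain ⟨h, hh⟩ := exists_isHarmonicDecomposition n p.2
  rw [harmonicProj_eq p hh, hh.2, Finset.sum_range_succ']
  simp [restrictConic_q]

theorem restrictConic_harmonicMul {m n : ℕ} (f : harmonicSpace m) (g : harmonicSpace n) :
    restrictConic (harmonicMul f g) = restrictConic f * restrictConic g := by
  rw [harmonicMul, restrictConic_harmonicProj, map_mul]

theorem restrictConic_linForm (w : EuclideanSpace ℝ (Fin 3)) :
    restrictConic (linForm w) = C (w 0 : ℂ) * (1 - X ^ 2) +
      C (w 1 : ℂ) * (C Complex.I * (1 + X ^ 2)) + C (w 2 : ℂ) * (2 * X) := by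
  simp [linForm, restrictConic, Fin.sum_univ_three, isotropicCurve,
    IsScalarTower.algebraMap_apply ℝ ℂ ℂ[X]]

/-! ### The antipodal real structure -/

/-- The antipodal conjugate `P ↦ u ^ m * conj (P (-1 / conj u))`, up to sign. -/
noncomputable def antipode (m : ℕ) (P : ℂ[X]) : ℂ[X] :=
  (reflect m (P.map (starRingEnd ℂ))).comp (-X)

theorem antipode_mul {m n : ℕ} {P R : ℂ[X]} (hP : P.natDegree ≤ m) (hR : R.natDegree ≤ n) :
    antipode (m + n) (P * R) = antipode m P * antipode n R := by
  rw [antipode, Polynomial.map_mul, reflect_mul, mul_comp, antipode, antipode]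
  · exact natDegree_map_le.trans hP
  · exact natDegree_map_le.trans hR

theorem antipode_add (m : ℕ) (P R : ℂ[X]) : antipode m (P + R) = antipode m P + antipode m R := by
  simp [antipode, reflect_add]

theorem antipode_zero (m : ℕ) : antipode m 0 = 0 := by
  simp [antipode]

/-- Binary forms of degree `2n` (dehomogenized) that are real for the antipodal structure. -/
def IsAntipodal (n : ℕ) (P : ℂ[X]) : Prop :=
  P.natDegree ≤ 2 * n ∧ antipode (2 * n) P = (-1) ^ n * P

theorem IsAntipodal.add {n : ℕ} {P R : ℂ[X]} (hP : IsAntipodal n P) (hR : IsAntipodal n R) :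
    IsAntipodal n (P + R) :=
  ⟨natDegree_add_le_of_degree_le hP.1 hR.1, by rw [antipode_add, hP.2, hR.2, mul_add]⟩

theorem IsAntipodal.zero (n : ℕ) : IsAntipodal n 0 := ⟨by simp, by simp [antipode_zero]⟩

theorem IsAntipodal.mul {m n : ℕ} {P R : ℂ[X]} (hP : IsAntipodal m P) (hR : IsAntipodal n R) :
    IsAntipodal (m + n) (P * R) := by
  refine ⟨natDegree_mul_le.trans ((add_le_add hP.1 hR.1).trans_eq (by ring)), ?_⟩
  rw [mul_add, antipode_mul hP.1 hR.1, hP.2, hR.2, pow_add]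
  ring

theorem IsAntipodal.algebraMap (a : ℝ) : IsAntipodal 0 (algebraMap ℝ ℂ[X] a) := by
  simp [IsAntipodal, antipode, IsScalarTower.algebraMap_apply ℝ ℂ ℂ[X], reflect_C]

theorem IsAntipodal.pow {P : ℂ[X]} (hP : IsAntipodal 1 P) (n : ℕ) : IsAntipodal n (P ^ n) := by
  induction n with
  | zero => simpa using IsAntipodal.algebraMap 1
  | succ n ih => rw [pow_succ]; exact ih.mul hP

theorem IsAntipodal.prod {ι : Type*} (s : Finset ι) (d : ι → ℕ) (P : ι → ℂ[X])
    (hP : ∀ i ∈ s, IsAntipodal (d i) (P i)) : IsAntipodal (∑ i ∈ s, d i) (∏ i ∈ s, P i) := by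
  classical
  induction s using Finset.induction_on with
  | empty => simpa using IsAntipodal.algebraMap 1
  | insert i s hi ih =>
    rw [Finset.sum_insert hi, Finset.prod_insert hi]
    exact (hP i (by simp)).mul (ih fun j hj => hP j (by simp [hj]))

theorem coeff_antipode (m : ℕ) (P : ℂ[X]) (k : ℕ) :
    (antipode m P).coeff k = (-1) ^ k * starRingEnd ℂ (P.coeff (revAt m k)) := by
  have : (-X : ℂ[X]) = C (-1) * X := by simp
  rw [antipode, this, comp_C_mul_X_coeff, coeff_reflect, coeff_map, mul_comm]

theorem IsAntipodal.coeff_eq {n : ℕ} {P : ℂ[X]} (hP : IsAntipodal n P) (k : ℕ) :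
    (-1) ^ k * starRingEnd ℂ (P.coeff (revAt (2 * n) k)) = (-1) ^ n * P.coeff k := by
  have h : ((-1) ^ n : ℂ[X]) = C ((-1) ^ n) := by simp
  rw [← coeff_antipode, hP.2, h, coeff_C_mul]

/-- A root at `0` forces its antipode, a root at `∞`, which shows as a drop in degree. -/
theorem IsAntipodal.natDegree_lt {n : ℕ} {P : ℂ[X]} (hP : IsAntipodal n P) (h0 : P ≠ 0)
    (hc : P.coeff 0 = 0) : P.natDegree < 2 * n := by
  refine lt_of_le_of_ne hP.1 fun h => h0 ?_
  have := hP.coeff_eq (2 * n)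
  rw [revAt_le le_rfl, Nat.sub_self, hc, ← h] at this
  simpa using this.symm

theorem isAntipodal_one_iff {P : ℂ[X]} : IsAntipodal 1 P ↔ P.natDegree ≤ 2 ∧
    starRingEnd ℂ (P.coeff 2) = -P.coeff 0 ∧ starRingEnd ℂ (P.coeff 1) = P.coeff 1 := by
  refine and_congr_right fun hd => ⟨fun h => ?_, fun h => ?_⟩
  · have h0 := congrArg (fun Q => coeff Q 0) h
    have h1 := congrArg (fun Q => coeff Q 1) h
    simp only [coeff_antipode] at h0 h1
    simpa [revAt] using And.intro h0 h1
  · have h0 : starRingEnd ℂ (P.coeff 0) = -P.coeff 2 := by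
      rw [← Complex.conj_conj (P.coeff 2), h.1, map_neg, neg_neg]
    ext k
    rw [coeff_antipode]
    match k with
    | 0 => simpa [revAt] using h.1
    | 1 => simpa [revAt] using h.2
    | 2 => simpa [revAt] using h0
    | k + 3 =>
      have : P.coeff (k + 3) = 0 := coeff_eq_zero_of_natDegree_lt (by omega)
      simp [revAt, this]

theorem isAntipodal_isotropicCurve (i : Fin 3) : IsAntipodal 1 (isotropicCurve i) := by
  rw [isAntipodal_one_iff]
  fin_cases i
  · refine ⟨?_, ?_⟩
    · change (1 - X ^ 2 : ℂ[X]).natDegree ≤ 2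
      compute_degree
    · simp [isotropicCurve, coeff_one, coeff_X_pow]
  · refine ⟨?_, ?_⟩
    · change (C Complex.I * (1 + X ^ 2) : ℂ[X]).natDegree ≤ 2
      compute_degree
    · simp [isotropicCurve, coeff_one]
  · refine ⟨?_, ?_⟩
    · change (2 * X : ℂ[X]).natDegree ≤ 2
      compute_degree
      norm_num
    · simp [isotropicCurve, coeff_X, map_ofNat]

theorem isAntipodal_restrictConic {n : ℕ} {p : MvPolynomial (Fin 3) ℝ} (hp : p.IsHomogeneous n) :
    IsAntipodal n (restrictConic p) := by
  rw [p.as_sum, map_sum]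
  refine Finset.sum_induction _ (IsAntipodal n) (fun _ _ => IsAntipodal.add)
    (IsAntipodal.zero n) fun d hd => ?_
  have hn : 0 + ∑ i ∈ d.support, d i = n := by
    rw [zero_add, ← hp (MvPolynomial.mem_support_iff.1 hd), Finsupp.weight_apply, Finsupp.sum]
    simp
  rw [restrictConic, MvPolynomial.aeval_monomial, ← hn]
  exact (IsAntipodal.algebraMap _).mul
    (IsAntipodal.prod _ _ _ fun i _ => (isAntipodal_isotropicCurve i).pow _)

theorem exists_linForm_of_isAntipodal {P : ℂ[X]} (hP : IsAntipodal 1 P) :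
    ∃ w, restrictConic (linForm w) = P := by
  obtain ⟨hd, h2, h1⟩ := isAntipodal_one_iff.1 hP
  -- The form of `w` restricts to constant term `w 0 + i w 1` and linear coefficient `2 w 2`;
  -- antipodality fixes the rest.
  refine ⟨!₂[(P.coeff 0).re, (P.coeff 0).im, (P.coeff 1).re / 2], ?_⟩
  have h3 : P.coeff 2 = -(starRingEnd ℂ) (P.coeff 0) := by
    rw [← map_neg, ← h2, Complex.conj_conj]
  rw [restrictConic_linForm]
  ext k
  match k with
  | 0 => simp [coeff_one, coeff_X, mul_comm, Complex.ext_iff]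
  | 1 =>
    have := Complex.conj_eq_iff_im.1 h1
    simp [coeff_one, coeff_X, Complex.ext_iff, this, coeff_X_pow]
  | 2 =>
    rw [h3]
    simp [coeff_one, coeff_X, Complex.ext_iff, coeff_X_pow]
  | k + 3 =>
    have hk : P.coeff (k + 3) = 0 := coeff_eq_zero_of_natDegree_lt (by omega)
    simp [coeff_one, coeff_X, hk]

/-! ### Splitting off antipodal pairs of roots -/

/-- The real quadratic form with antipodal roots `r` and `-1 / conj r`. -/
noncomputable def antipodalPair (r : ℂ) : ℂ[X] := (X - C r) * (1 + C (starRingEnd ℂ r) * X)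

theorem isAntipodal_antipodalPair (r : ℂ) : IsAntipodal 1 (antipodalPair r) := by
  have : antipodalPair r = C (starRingEnd ℂ r) * X ^ 2 + C (1 - r * starRingEnd ℂ r) * X
      + C (-r) := by
    simp only [antipodalPair, C_sub, C_mul, C_neg, C_1]
    ring
  rw [isAntipodal_one_iff, this]
  refine ⟨by compute_degree, ?_, ?_⟩
  · simp [coeff_one]
  · simp [coeff_C, coeff_one, mul_comm r]

theorem antipode_X_sub_C (r : ℂ) : antipode 1 (X - C r) = 1 + C (starRingEnd ℂ r) * X := by
  simp [antipode, reflect_sub, reflect_C]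

/-- No point is its own antipode, because `1 + |r|² ≠ 0`. -/
theorem isCoprime_antipodal (r : ℂ) :
    IsCoprime (X - C r) (1 + C (starRingEnd ℂ r) * X) := by
  have h : (1 + r * starRingEnd ℂ r) ≠ 0 := by
    rw [Complex.mul_conj]
    exact_mod_cast (add_pos_of_pos_of_nonneg one_pos (Complex.normSq_nonneg r)).ne'
  refine ⟨-C (1 + r * starRingEnd ℂ r)⁻¹ * C (starRingEnd ℂ r), C (1 + r * starRingEnd ℂ r)⁻¹, ?_⟩
  have h2 : (C (1 + r * starRingEnd ℂ r)⁻¹ : ℂ[X]) * (1 + C r * C (starRingEnd ℂ r)) = 1 := by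
    rw [← C_mul, ← C_1, ← C_add, ← C_mul, inv_mul_cancel₀ h]
  linear_combination h2

theorem antipodalPair_dvd {n : ℕ} {P : ℂ[X]} (hP : IsAntipodal (n + 1) P) {r : ℂ}
    (hr : P.IsRoot r) : antipodalPair r ∣ P := by
  refine (isCoprime_antipodal r).mul_dvd (dvd_iff_isRoot.2 hr) ?_
  obtain ⟨R, rfl⟩ := dvd_iff_isRoot.2 hr
  by_cases hR : R = 0
  · simp [hR]
  have hd := hP.1
  rw [natDegree_mul (X_sub_C_ne_zero r) hR, natDegree_X_sub_C] at hd
  -- Applying the antipode to `(X - r) R` turns the factor `X - r` into its partner, while the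
  -- product changes only by a sign.
  have h := hP.2
  rw [show 2 * (n + 1) = 1 + (2 * n + 1) by ring,
    antipode_mul (natDegree_X_sub_C_le r) (by omega), antipode_X_sub_C] at h
  have h1 : (-1 : ℂ[X]) ^ (n + 1) * (-1) ^ (n + 1) = 1 := by
    rw [← mul_pow]
    simp
  exact ⟨(-1) ^ (n + 1) * antipode (2 * n + 1) R, by
    linear_combination (-(-1) ^ (n + 1)) * h - (X - C r) * R * h1⟩

theorem antipodalPair_ne_zero (r : ℂ) : antipodalPair r ≠ 0 := by
  refine mul_ne_zero (X_sub_C_ne_zero r) fun h => ?_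
  simpa using congrArg (eval 0) h

theorem natDegree_antipodalPair {r : ℂ} (hr : r ≠ 0) : (antipodalPair r).natDegree = 2 := by
  have h0 : starRingEnd ℂ r ≠ 0 := (_root_.map_ne_zero _).2 hr
  rw [antipodalPair]
  compute_degree!

theorem IsAntipodal.of_mul {m n : ℕ} {P Q : ℂ[X]} (hQ : IsAntipodal m Q) (hQ0 : Q ≠ 0)
    (hd : P.natDegree ≤ 2 * n) (h : IsAntipodal (n + m) (P * Q)) : IsAntipodal n P := by
  refine ⟨hd, mul_right_cancel₀ (mul_ne_zero (pow_ne_zero m (neg_ne_zero.2 one_ne_zero)) hQ0) ?_⟩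
  have := h.2
  rw [mul_add, antipode_mul hd hQ.1, hQ.2] at this
  rw [this, pow_add]
  ring

/-- A constant has zero coefficient in degree `2(n + 1) > 0`, so antipodality makes its constant
term vanish too. -/
theorem exists_isRoot_of_isAntipodal {n : ℕ} {P : ℂ[X]} (hP : IsAntipodal (n + 1) P) :
    ∃ r, P.IsRoot r := by
  by_contra! hr
  have h0 : P.degree = 0 := by
    by_contra h
    obtain ⟨r, h⟩ := IsAlgClosed.exists_root P h
    exact hr r h
  rw [eq_C_of_degree_eq_zero h0] at hP hr
  have h := hP.coeff_eq 0
  refine hr 0 ?_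
  simpa [revAt_le, coeff_C] using h.symm

theorem restrictConic_sylvesterMap_succ (n : ℕ) (w : Fin n → EuclideanSpace ℝ (Fin 3))
    (v : EuclideanSpace ℝ (Fin 3)) :
    restrictConic (sylvesterMap (n + 1) (Fin.snoc w v)) =
      restrictConic (sylvesterMap n w) * restrictConic (linForm v) := by
  simp [sylvesterMap, restrictConic_harmonicMul]

/-- Every nonconstant real form on the conic is a product of real linear forms. -/
theorem exists_sylvesterMap_of_isAntipodal {n : ℕ} {P : ℂ[X]} (hP : IsAntipodal (n + 1) P) :
    ∃ w, restrictConic (sylvesterMap (n + 1) w) = P := by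
  induction n generalizing P with
  | zero =>
    obtain ⟨v, hv⟩ := exists_linForm_of_isAntipodal hP
    refine ⟨Fin.snoc Fin.elim0 v, ?_⟩
    rw [restrictConic_sylvesterMap_succ, hv]
    simp [sylvesterMap, harmonicOne]
  | succ n ih =>
    obtain ⟨r, hr⟩ := exists_isRoot_of_isAntipodal hP
    obtain ⟨v, hv⟩ := exists_linForm_of_isAntipodal (isAntipodal_antipodalPair r)
    obtain ⟨R, rfl⟩ := antipodalPair_dvd hP hr
    have hR : IsAntipodal (n + 1) R := by
      by_cases hR : R = 0
      · exact hR ▸ IsAntipodal.zero _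
      rw [mul_comm] at hP
      refine IsAntipodal.of_mul (isAntipodal_antipodalPair r) (antipodalPair_ne_zero r) ?_ hP
      have hd := hP.1
      rw [natDegree_mul hR (antipodalPair_ne_zero r)] at hd
      by_cases h0 : r = 0
      -- For `r = 0` the pair is just `X`, its other root being `∞`; the strict degree bound
      -- supplies the missing unit.
      · have hlt := hP.natDegree_lt (mul_ne_zero hR (antipodalPair_ne_zero r))
          (by simp [antipodalPair, h0])
        rw [natDegree_mul hR (antipodalPair_ne_zero r), h0, antipodalPair] at hlt
        simp at hlt
        omega
      · rw [natDegree_antipodalPair h0] at hd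
        omega
    obtain ⟨w, hw⟩ := ih hR
    exact ⟨Fin.snoc w v, by rw [restrictConic_sylvesterMap_succ, hv, hw, mul_comm]⟩

end HarmonicPoly

theorem mainTheorem1 (n : ℕ) (hn : 1 ≤ n) (h : MvPolynomial (Fin 3) ℝ)
    (hhom : h.IsHomogeneous n) (hharm : HarmonicPoly.laplacian h = 0) :
    ∃ w : Fin n → EuclideanSpace ℝ (Fin 3),
      h = (HarmonicPoly.sylvesterMap n w : MvPolynomial (Fin 3) ℝ) := by
  obtain ⟨m, rfl⟩ := Nat.exists_eq_add_of_le' hn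
  obtain ⟨w, hw⟩ := HarmonicPoly.exists_sylvesterMap_of_isAntipodal
    (HarmonicPoly.isAntipodal_restrictConic hhom)
  refine ⟨w, sub_eq_zero.1 (HarmonicPoly.eq_zero_of_restrictConic_eq_zero (n := m + 1)
    (Submodule.sub_mem _ (HarmonicPoly.mem_harmonicSpace.2 ⟨hhom, hharm⟩)
      (HarmonicPoly.sylvesterMap _ w).2) ?_)⟩
  rw [map_sub, hw, sub_self]
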